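/- Let $\mathcal M$ be the set of isometry classes of nonempty compact metric spaces, with the Gromov–Hausdorff metric $d_{GH}(X,Y)=\inf d_{H,Z}(X,Y)$, where $d_{H,Z}$ is the Hausdorff distance in $Z$ and the infimum is over all metric spaces $Z$ containing $X$ and $Y$ as isometrically embedded subspaces. For a nonempty compact metric space $X$, let $\dim X$ be its covering dimension: the least integer $m\ge 0$ such that every finite open cover of $X$ has a finite open refinement covering $X$ in which no $m+2$ distinct members have a common point ($\dim X=\infty$ if there is no such $m$). For an integer $n\ge 0$ let $\mathcal M_{\le n}\subseteq\mathcal M$ (respectively $\mathcal M_n\subseteq\mathcal M$) be the set of isometry classes of spaces $X$ with $\dim X\le n$ (respectively $\dim X=n$). Then for every integer $n\ge 0$ the set $\mathcal M_{\le n}$ is a dense $G_\delta$ subset of $\mathcal M$, and $\mathcal M_{\le n}$, with the subspace topology, is a Baire space (countable intersections of dense open subsets are dense). In particular, $\mathcal M_0=\mathcal M_{\le 0}$ is a dense $G_\delta$ subset of $\mathcal M$ and a Baire space. -/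

import Mathlib

namespace GHDim

open GromovHausdorff

/-- A finite family of open sets covering `X`. -/
def IsFiniteOpenCover (X : Type*) [TopologicalSpace X] (𝒰 : Finset (Set X)) : Prop :=
  (∀ U ∈ 𝒰, IsOpen U) ∧ ⋃₀ (𝒰 : Set (Set X)) = Set.univ

/-- `𝒱` refines `𝒰`: each member of `𝒱` is contained in a member of `𝒰`. -/
def Refines {X : Type*} (𝒱 𝒰 : Finset (Set X)) : Prop :=
  ∀ V ∈ 𝒱, ∃ U ∈ 𝒰, V ⊆ U

/-- The family `𝒰` has order at most `n`: no `n + 2` distinct members have a common point. -/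
def OrderLE {X : Type*} (𝒰 : Finset (Set X)) (n : ℕ) : Prop :=
  ∀ 𝒲 ⊆ 𝒰, 𝒲.card = n + 2 → ⋂₀ (𝒲 : Set (Set X)) = ∅

/-- Every finite open cover of `X` is refined by a finite open cover of order at most `n`. -/
def HasRefinementsOfOrderLE (X : Type*) [TopologicalSpace X] (n : ℕ) : Prop :=
  ∀ 𝒰 : Finset (Set X), IsFiniteOpenCover X 𝒰 →
    ∃ 𝒱 : Finset (Set X), IsFiniteOpenCover X 𝒱 ∧ Refines 𝒱 𝒰 ∧ OrderLE 𝒱 n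

open Classical in
/-- The covering dimension of `X`: the least `n` such that every finite open cover has a finite
open refinement of order at most `n`, and `⊤` if there is no such `n`. The dimension of the empty
space, conventionally `-1`, is `⊥`. -/
noncomputable def coveringDim (X : Type*) [TopologicalSpace X] : WithBot ℕ∞ :=
  if IsEmpty X then ⊥
  else ((⨅ (n : ℕ) (_ : HasRefinementsOfOrderLE X n), (n : ℕ∞) : ℕ∞) : WithBot ℕ∞)

/-- The set `ℳ_{≤ n}` of isometry classes of (nonempty) compact metric spaces of covering
dimension at most `n`, inside the Gromov-Hausdorff space. -/
def dimLE (n : ℕ) : Set GHSpace :=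
  {p | coveringDim p.Rep ≤ ((n : ℕ∞) : WithBot ℕ∞)}

/-- The set `ℳ_n` of isometry classes of (nonempty) compact metric spaces of covering
dimension exactly `n`, inside the Gromov-Hausdorff space. -/
def dimEq (n : ℕ) : Set GHSpace :=
  {p | coveringDim p.Rep = ((n : ℕ∞) : WithBot ℕ∞)}

/-! The covering dimension is a homeomorphism invariant, so membership in the sets above does not
depend on the chosen representative of the isometry class. -/

theorem HasRefinementsOfOrderLE.of_homeomorph {X Y : Type*} [TopologicalSpace X]
    [TopologicalSpace Y] (e : X ≃ₜ Y) {n : ℕ} (h : HasRefinementsOfOrderLE X n) :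
    HasRefinementsOfOrderLE Y n := by
  intro 𝒰 h𝒰
  let f : Set X ↪ Set Y := ⟨fun s => e '' s, e.injective.image_injective⟩
  let g : Set Y ↪ Set X := ⟨fun s => e ⁻¹' s, e.surjective.preimage_injective⟩
  obtain ⟨𝒱, ⟨hVo, hVc⟩, hr, ho⟩ := h (𝒰.map g) (by
    refine ⟨?_, ?_⟩
    · intro U hU
      obtain ⟨U', hU', rfl⟩ := Finset.mem_map.1 hU
      exact (h𝒰.1 U' hU').preimage e.continuous
    · refine Set.eq_univ_of_forall fun x => ?_
      obtain ⟨U, hU, hx⟩ : e x ∈ ⋃₀ (𝒰 : Set (Set Y)) := h𝒰.2 ▸ Set.mem_univ _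
      exact ⟨g U, by simpa using hU, hx⟩)
  refine ⟨𝒱.map f, ⟨?_, ?_⟩, ?_, ?_⟩
  · intro V hV
    obtain ⟨V', hV', rfl⟩ := Finset.mem_map.1 hV
    exact e.isOpenMap _ (hVo V' hV')
  · refine Set.eq_univ_of_forall fun y => ?_
    obtain ⟨V, hV, hx⟩ : e.symm y ∈ ⋃₀ (𝒱 : Set (Set X)) := hVc ▸ Set.mem_univ _
    exact ⟨f V, by simpa using hV, ⟨e.symm y, hx, e.apply_symm_apply y⟩⟩
  · intro V hV
    obtain ⟨V', hV', rfl⟩ := Finset.mem_map.1 hV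
    obtain ⟨U, hU, hs⟩ := hr V' hV'
    obtain ⟨U', hU', rfl⟩ := Finset.mem_map.1 hU
    exact ⟨U', hU', Set.image_subset_iff.2 hs⟩
  · intro 𝒲 hW hc
    have hsub : 𝒲.map g ⊆ 𝒱 := by
      intro W hWm
      obtain ⟨W', hW', rfl⟩ := Finset.mem_map.1 hWm
      obtain ⟨V, hV, rfl⟩ := Finset.mem_map.1 (hW hW')
      have : g (f V) = V := e.injective.preimage_image V
      rwa [this]
    have h0 := ho _ hsub (by rw [Finset.card_map, hc])
    refine Set.eq_empty_of_forall_notMem fun y hy => ?_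
    have : e.symm y ∈ ⋂₀ ((𝒲.map g : Finset (Set X)) : Set (Set X)) := by
      intro W hWm
      obtain ⟨W', hW', rfl⟩ := Finset.mem_map.1 (Finset.mem_coe.1 hWm)
      change e (e.symm y) ∈ W'
      rw [e.apply_symm_apply]
      exact hy W' hW'
    rw [h0] at this
    exact this

theorem coveringDim_congr {X Y : Type*} [TopologicalSpace X] [TopologicalSpace Y] (e : X ≃ₜ Y) :
    coveringDim X = coveringDim Y := by
  have h : ∀ n, HasRefinementsOfOrderLE X n ↔ HasRefinementsOfOrderLE Y n :=
    fun n => ⟨fun h => h.of_homeomorph e, fun h => h.of_homeomorph e.symm⟩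
  have h' : IsEmpty X ↔ IsEmpty Y := e.toEquiv.isEmpty_congr
  unfold coveringDim
  by_cases hX : IsEmpty X
  · rw [if_pos hX, if_pos (h'.1 hX)]
  · rw [if_neg hX, if_neg fun hY => hX (h'.2 hY)]
    simp only [h]

theorem coveringDim_rep_toGHSpace (X : Type*) [MetricSpace X] [CompactSpace X] [Nonempty X] :
    coveringDim (toGHSpace X).Rep = coveringDim X := by
  obtain ⟨e⟩ := toGHSpace_eq_toGHSpace_iff_isometryEquiv.1 (GHSpace.toGHSpace_rep (toGHSpace X))
  exact coveringDim_congr e.toHomeomorph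

theorem toGHSpace_mem_dimLE (X : Type*) [MetricSpace X] [CompactSpace X] [Nonempty X] (n : ℕ) :
    toGHSpace X ∈ dimLE n ↔ coveringDim X ≤ ((n : ℕ∞) : WithBot ℕ∞) := by
  rw [← coveringDim_rep_toGHSpace X]; rfl

theorem toGHSpace_mem_dimEq (X : Type*) [MetricSpace X] [CompactSpace X] [Nonempty X] (n : ℕ) :
    toGHSpace X ∈ dimEq n ↔ coveringDim X = ((n : ℕ∞) : WithBot ℕ∞) := by
  rw [← coveringDim_rep_toGHSpace X]; rfl

end GHDim

namespace GHDim

open GromovHausdorff Set Metric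

/-! By Lebesgue numbers, a nonempty compact metric space has dimension at most `n` iff for every `k`
it has a finite open cover of order at most `n` and mesh below `1 / (k + 1)`. For fixed `k` this
condition is Gromov–Hausdorff open (`HasFineCover.exists_forall_ghDist_lt`), so `dimLE n` is a `Gδ`.
It is dense because finite spaces have dimension 0 and finite nets approximate every compact space.
A dense `Gδ` in the complete space `GHSpace` is Baire. -/

theorem OrderLE.mono {X : Type*} {𝒰 : Finset (Set X)} {m n : ℕ} (h : OrderLE 𝒰 m) (hmn : m ≤ n) :
    OrderLE 𝒰 n := by
  intro 𝒲 hW hc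
  obtain ⟨𝒲', hs, hc'⟩ := Finset.exists_subset_card_eq (s := 𝒲) (n := m + 2) (by omega)
  have := h 𝒲' (hs.trans hW) hc'
  exact subset_empty_iff.1 (this ▸ sInter_subset_sInter (Finset.coe_subset.2 hs))

theorem coveringDim_le_iff (X : Type*) [TopologicalSpace X] [Nonempty X] (n : ℕ) :
    coveringDim X ≤ ((n : ℕ∞) : WithBot ℕ∞) ↔ HasRefinementsOfOrderLE X n := by
  unfold coveringDim
  rw [if_neg (not_isEmpty_of_nonempty X), WithBot.coe_le_coe]
  constructor
  · intro h
    -- A strict bound by `n + 1` makes `iInf_lt_iff` produce an actual witness `m ≤ n`.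
    have h' := h.trans_lt (Nat.cast_lt.2 n.lt_succ_self : (n : ℕ∞) < ((n + 1 : ℕ) : ℕ∞))
    simp only [iInf_lt_iff] at h'
    obtain ⟨m, hm, hlt⟩ := h'
    intro 𝒰 hU
    obtain ⟨𝒱, hV, hr, ho⟩ := hm 𝒰 hU
    exact ⟨𝒱, hV, hr, ho.mono (Nat.lt_succ_iff.1 (Nat.cast_lt.1 hlt))⟩
  · exact fun h => iInf₂_le n h

theorem coveringDim_nonneg (X : Type*) [TopologicalSpace X] [Nonempty X] :
    (((0 : ℕ) : ℕ∞) : WithBot ℕ∞) ≤ coveringDim X := by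
  unfold coveringDim
  rw [if_neg (not_isEmpty_of_nonempty X), WithBot.coe_le_coe]
  exact zero_le

theorem dimEq_zero : dimEq 0 = dimLE 0 := by
  ext p
  exact ⟨fun h => le_of_eq h, fun h => le_antisymm h (coveringDim_nonneg p.Rep)⟩

/-- `X` has a finite open cover of order at most `n` and mesh less than `ε`. -/
def HasFineCover (X : Type*) [MetricSpace X] (n : ℕ) (ε : ℝ) : Prop :=
  ∃ 𝒱 : Finset (Set X), IsFiniteOpenCover X 𝒱 ∧ OrderLE 𝒱 n ∧
    ∃ η < ε, ∀ V ∈ 𝒱, ∀ x ∈ V, ∀ y ∈ V, dist x y ≤ η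

theorem HasRefinementsOfOrderLE.hasFineCover {X : Type*} [MetricSpace X] [CompactSpace X] {n : ℕ}
    (h : HasRefinementsOfOrderLE X n) {ε : ℝ} (hε : 0 < ε) : HasFineCover X n ε := by
  classical
  obtain ⟨t, -, htf, ht⟩ := finite_cover_balls_of_compact (isCompact_univ (X := X))
    (by positivity : 0 < ε / 4)
  obtain ⟨𝒱, hV, hr, ho⟩ := h (htf.toFinset.image fun x => ball x (ε / 4)) (by
    refine ⟨?_, eq_univ_of_forall fun x => ?_⟩
    · intro U hU
      obtain ⟨x, -, rfl⟩ := Finset.mem_image.1 hU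
      exact isOpen_ball
    · obtain ⟨y, hy, hxy⟩ := mem_iUnion₂.1 (ht (mem_univ x))
      exact ⟨_, Finset.mem_coe.2 (Finset.mem_image_of_mem _ (htf.mem_toFinset.2 hy)), hxy⟩)
  refine ⟨𝒱, hV, ho, ε / 2, by linarith, fun V hVm x hx y hy => ?_⟩
  obtain ⟨U, hU, hVU⟩ := hr V hVm
  obtain ⟨z, -, rfl⟩ := Finset.mem_image.1 hU
  have h1 := mem_ball.1 (hVU hx)
  have h2 := mem_ball.1 (hVU hy)
  linarith [dist_triangle_right x y z]

theorem hasRefinementsOfOrderLE_of_hasFineCover {X : Type*} [MetricSpace X] [CompactSpace X]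
    [Nonempty X] {n : ℕ} (h : ∀ k : ℕ, HasFineCover X n (1 / (k + 1))) :
    HasRefinementsOfOrderLE X n := by
  intro 𝒰 hU
  obtain ⟨δ, hδ, hb⟩ := lebesgue_number_lemma_of_metric_sUnion (isCompact_univ (X := X))
    (c := (𝒰 : Set (Set X))) hU.1 hU.2.ge
  obtain ⟨k, hk⟩ := exists_nat_one_div_lt hδ
  obtain ⟨𝒱, hV, ho, η, hη, hm⟩ := h k
  refine ⟨𝒱, hV, fun V hVm => ?_, ho⟩
  -- An empty `V` still needs a member of `𝒰` above it, which exists since `X` is nonempty.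
  rcases V.eq_empty_or_nonempty with rfl | ⟨x, hx⟩
  · obtain ⟨U, hUm, -⟩ := hb (Classical.arbitrary X) (mem_univ _)
    exact ⟨U, hUm, empty_subset _⟩
  · obtain ⟨U, hUm, hs⟩ := hb x (mem_univ _)
    refine ⟨U, hUm, fun y hy => hs (mem_ball.2 ?_)⟩
    linarith [hm V hVm y hy x hx]

theorem exists_optimalGH_dist_lt {X Y : Type*} [MetricSpace X] [CompactSpace X] [Nonempty X]
    [MetricSpace Y] [CompactSpace Y] [Nonempty Y] {r : ℝ} (h : ghDist X Y < r) (y : Y) :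
    ∃ x : X, dist (optimalGHInjl X Y x) (optimalGHInjr X Y y) < r := by
  rw [← hausdorffDist_optimal] at h
  obtain ⟨_, ⟨x, rfl⟩, hx⟩ := exists_dist_lt_of_hausdorffDist_lt' (mem_range_self y) h
    (hausdorffEDist_ne_top_of_nonempty_of_bounded (range_nonempty _) (range_nonempty _)
      (isCompact_range (isometry_optimalGHInjl X Y).continuous).isBounded
      (isCompact_range (isometry_optimalGHInjr X Y).continuous).isBounded)
  exact ⟨x, hx⟩

/-- Having a fine cover of given order is stable under small Gromov-Hausdorff perturbations: a
cover of `X` is moved to `Y` through the optimal coupling, after shrinking its members by a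
Lebesgue number. -/
theorem HasFineCover.exists_forall_ghDist_lt {X : Type*} [MetricSpace X] [CompactSpace X]
    [Nonempty X] {n : ℕ} {ε : ℝ} (h : HasFineCover X n ε) :
    ∃ r > 0, ∀ (Y : Type*) [MetricSpace Y] [CompactSpace Y] [Nonempty Y],
      ghDist X Y < r → HasFineCover Y n ε := by
  classical
  obtain ⟨𝒱, hV, ho, η, hη, hm⟩ := h
  obtain ⟨δ, hδ, hb⟩ := lebesgue_number_lemma_of_metric_sUnion (isCompact_univ (X := X))
    (c := (𝒱 : Set (Set X))) hV.1 hV.2.ge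
  -- `2 * r ≤ δ` preserves the order; `η + 2 * r < ε` preserves the mesh bound.
  refine ⟨min (δ / 2) ((ε - η) / 4), lt_min (by linarith) (by linarith), ?_⟩
  intro Y _ _ _ hXY
  set r := min (δ / 2) ((ε - η) / 4)
  have hrδ : r ≤ δ / 2 := min_le_left _ _
  have hrε : r ≤ (ε - η) / 4 := min_le_right _ _
  let Φ := optimalGHInjl X Y
  let Ψ := optimalGHInjr X Y
  have hΦ : Isometry Φ := isometry_optimalGHInjl X Y
  have hΨ : Isometry Ψ := isometry_optimalGHInjr X Y
  -- Only centres of `δ`-balls inside `V` are transported, leaving room for the error `2 * r`.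
  let T : Set X → Set Y := fun V => {y | ∃ x, ball x δ ⊆ V ∧ dist (Φ x) (Ψ y) < r}
  refine ⟨𝒱.image T, ⟨?_, ?_⟩, ?_, η + 2 * r, by linarith, ?_⟩
  · intro W hW
    obtain ⟨V, -, rfl⟩ := Finset.mem_image.1 hW
    have : T V = ⋃ (x) (_ : ball x δ ⊆ V), {y | dist (Φ x) (Ψ y) < r} := by
      ext y
      simp [T]
    rw [this]
    exact isOpen_biUnion fun x _ =>
      isOpen_lt (continuous_const.dist hΨ.continuous) continuous_const
  · refine eq_univ_of_forall fun y => ?_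
    obtain ⟨x, hx⟩ := exists_optimalGH_dist_lt hXY y
    obtain ⟨V, hVm, hs⟩ := hb x (mem_univ _)
    exact ⟨T V, Finset.mem_coe.2 (Finset.mem_image_of_mem _ hVm), x, hs, hx⟩
  · intro 𝒲 hW hc
    -- `T` may identify members of `𝒱`; one preimage per member of `𝒲` keeps the cardinality `n +
    -- 2`.
    obtain ⟨𝒱', hsub, hinj, rfl⟩ := Finset.exists_subset_injOn_image_eq_of_surjOn (f := T)
      (𝒱 : Set (Set X)) 𝒲 fun W hWm => by
        simpa using hW (Finset.mem_coe.1 hWm)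
    rw [Finset.card_image_of_injOn hinj] at hc
    refine eq_empty_of_forall_notMem fun y hy => ?_
    -- A single `x₀` close to `y` is within `δ` of every chosen centre, hence lies in all of `𝒱'`.
    obtain ⟨x₀, hx₀⟩ := exists_optimalGH_dist_lt hXY y
    have : x₀ ∈ ⋂₀ (𝒱' : Set (Set X)) := by
      intro V hVm
      obtain ⟨x, hs, hx⟩ := hy (T V) (Finset.mem_coe.2 (Finset.mem_image_of_mem _ hVm))
      refine hs (mem_ball.2 ?_)
      rw [← hΦ.dist_eq]
      have h₀ : dist (Φ x₀) (Ψ y) < r := hx₀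
      linarith [dist_triangle_right (Φ x₀) (Φ x) (Ψ y)]
    rw [ho 𝒱' (by exact_mod_cast hsub) hc] at this
    exact this
  · intro W hW y hy y' hy'
    obtain ⟨V, hVm, rfl⟩ := Finset.mem_image.1 hW
    obtain ⟨x, hs, hx⟩ := hy
    obtain ⟨x', hs', hx'⟩ := hy'
    have h1 := hm V hVm x (hs (mem_ball_self hδ)) x' (hs' (mem_ball_self hδ))
    rw [← hΦ.dist_eq] at h1
    rw [← hΨ.dist_eq]
    linarith [dist_triangle4 (Ψ y) (Φ x) (Φ x') (Ψ y'), dist_comm (Ψ y) (Φ x)]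

theorem isOpen_setOf_hasFineCover (n : ℕ) (ε : ℝ) :
    IsOpen {p : GHSpace | HasFineCover p.Rep n ε} := by
  refine Metric.isOpen_iff.2 fun p hp => ?_
  obtain ⟨r, hr, h⟩ := HasFineCover.exists_forall_ghDist_lt hp
  refine ⟨r, hr, fun q hq => h q.Rep ?_⟩
  rwa [← dist_ghDist, dist_comm]

theorem dimLE_eq_iInter (n : ℕ) :
    dimLE n = ⋂ k : ℕ, {p : GHSpace | HasFineCover p.Rep n (1 / (k + 1))} := by
  ext p
  rw [mem_iInter]
  change coveringDim p.Rep ≤ _ ↔ _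
  rw [coveringDim_le_iff]
  exact ⟨fun h k => h.hasFineCover (by positivity), hasRefinementsOfOrderLE_of_hasFineCover⟩

theorem isGδ_dimLE (n : ℕ) : IsGδ (dimLE n) := by
  rw [dimLE_eq_iInter]
  exact IsGδ.iInter_of_isOpen fun k => isOpen_setOf_hasFineCover n _

/-- The singletons form a disjoint open cover that refines every cover. -/
theorem hasRefinementsOfOrderLE_of_finite (X : Type*) [TopologicalSpace X] [DiscreteTopology X]
    [Finite X] (n : ℕ) : HasRefinementsOfOrderLE X n := by
  classical
  intro 𝒰 hU
  have := Fintype.ofFinite X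
  refine ⟨Finset.univ.image fun x : X => ({x} : Set X), ⟨fun _ _ => isOpen_discrete _, ?_⟩, ?_, ?_⟩
  · exact eq_univ_of_forall fun x => ⟨{x}, by simp, rfl⟩
  · intro V hV
    obtain ⟨x, -, rfl⟩ := Finset.mem_image.1 hV
    obtain ⟨U, hUm, hx⟩ : x ∈ ⋃₀ (𝒰 : Set (Set X)) := hU.2 ▸ mem_univ _
    exact ⟨U, hUm, singleton_subset_iff.2 hx⟩
  · intro 𝒲 hW hc
    refine eq_empty_of_forall_notMem fun x hx => ?_
    have hle : 𝒲.card ≤ 1 := by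
      have hs : ∀ W ∈ 𝒲, W = {x} := by
        intro W hWm
        obtain ⟨z, -, rfl⟩ := Finset.mem_image.1 (hW hWm)
        rw [mem_singleton_iff.1 (hx _ hWm)]
      exact Finset.card_le_one.2 fun a ha b hb => (hs a ha).trans (hs b hb).symm
    omega

theorem dense_dimLE (n : ℕ) : Dense (dimLE n) := by
  refine Metric.dense_iff.2 fun p ε hε => ?_
  obtain ⟨t, -, htf, ht⟩ := finite_cover_balls_of_compact (isCompact_univ (X := p.Rep))
    (half_pos hε)
  have hcov : ∀ x : p.Rep, ∃ y ∈ t, dist x y < ε / 2 := fun x => by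
    simpa using ht (mem_univ x)
  have : Finite t := htf
  have : Nonempty t := by
    obtain ⟨y, hy, -⟩ := hcov (Classical.arbitrary _)
    exact ⟨⟨y, hy⟩⟩
  -- The finite `ε / 2`-net `t`, with the induced metric, is the approximating space.
  refine ⟨toGHSpace t, ?_, ?_⟩
  · rw [mem_ball, dist_comm]
    have h1 : dist p (toGHSpace t) = ghDist p.Rep t := by
      rw [ghDist, GHSpace.toGHSpace_rep]
    have h2 : ghDist p.Rep t ≤
        hausdorffDist (range (id : p.Rep → p.Rep)) (range ((↑) : t → p.Rep)) :=
      ghDist_le_hausdorffDist isometry_id isometry_subtype_coe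
    have h3 : hausdorffDist (range (id : p.Rep → p.Rep)) (range ((↑) : t → p.Rep)) ≤ ε / 2 := by
      refine hausdorffDist_le_of_mem_dist (half_pos hε).le ?_ ?_
      · intro x _
        obtain ⟨y, hy, hxy⟩ := hcov x
        exact ⟨y, ⟨⟨y, hy⟩, rfl⟩, hxy.le⟩
      · intro x _
        exact ⟨x, ⟨x, rfl⟩, by simpa using (half_pos hε).le⟩
    linarith
  · rw [toGHSpace_mem_dimLE, coveringDim_le_iff]
    exact hasRefinementsOfOrderLE_of_finite _ n

theorem dense_isGδ_baireSpace_dimLE (n : ℕ) :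
    Dense (dimLE n) ∧ IsGδ (dimLE n) ∧ BaireSpace ↥(dimLE n) :=
  ⟨dense_dimLE n, isGδ_dimLE n, (isGδ_dimLE n).baireSpace_of_dense (dense_dimLE n)⟩

end GHDim

theorem proposition1p4 :
    (∀ n : ℕ, Dense (GHDim.dimLE n) ∧ IsGδ (GHDim.dimLE n) ∧ BaireSpace ↥(GHDim.dimLE n)) ∧
      (Dense (GHDim.dimEq 0) ∧ IsGδ (GHDim.dimEq 0) ∧ BaireSpace ↥(GHDim.dimEq 0)) := by
  refine ⟨GHDim.dense_isGδ_baireSpace_dimLE, ?_⟩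
  rw [GHDim.dimEq_zero]
  exact GHDim.dense_isGδ_baireSpace_dimLE 0
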